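/- Let $L$ be a countable first-order language, $T$ an $L$-theory, and $\mathcal U$ a monster model of $T$, that is, $\mathcal U \models T$ is $\kappa$-saturated and strongly $\kappa$-homogeneous for some uncountable cardinal $\kappa$. Let $M \preceq \mathcal U$ be a countable elementary submodel and let $\phi(x;y)$ be an $L$-formula, with $x$ and $y$ finite tuples of variables, which is NIP: there is no infinite set $A$ of $|x|$-tuples of $\mathcal U$ with $|y|$-tuples $b_I$ of $\mathcal U$, for $I \subseteq A$, such that $\mathcal U \models \phi(a;b_I) \iff a \in I$ for all $a \in A$. Let $S_\phi(\mathcal U)$ be the space of $\phi$-types over $\mathcal U$, i.e. of maximal consistent sets of formulas of the form $\phi(x;b)$ or $\neg\phi(x;b)$ with $b$ from $\mathcal U$, with the topology generated by the sets of types containing a given such formula. Let $\mathrm{Inv}_\phi(M) \subseteq S_\phi(\mathcal U)$ be the subspace of types that are invariant under all automorphisms of $\mathcal U$ fixing $M$ pointwise. For $p \in \mathrm{Inv}_\phi(M)$ let $d_p : S_y(M) \to \{0,1\} \subseteq \mathbb R$ be the function on the space of complete types over $M$ in $y$ with $d_p(q) = 1$ if $\phi(x;b) \in p$ for some realization $b$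 of $q$ in $\mathcal U$, and $d_p(q) = 0$ otherwise. Then $\mathrm{Inv}_\phi(M)$ is a Rosenthal compactum, that is, a compact Hausdorff space which embeds in the space $B_1(X)$ of Baire class 1 functions (pointwise limits of sequences of continuous real functions) on some Polish space $X$, with the topology of pointwise convergence. More precisely, $S_y(M)$ is a Polish space, every $d_p$ is of Baire class 1, and $p \mapsto d_p$ is a topological embedding of $\mathrm{Inv}_\phi(M)$ in $B_1(S_y(M))$ with compact image. -/

import Mathlib

open FirstOrder FirstOrder.Language Cardinal Filter Topology Set

/-! ### Functions of Baire class 1 and Rosenthal compacta -/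

/-- A real function is of Baire class 1 if it is the pointwise limit of a sequence of
continuous functions. -/
def IsBaireOne {X : Type*} [TopologicalSpace X] (f : X → ℝ) : Prop :=
  ∃ F : ℕ → X → ℝ, (∀ n, Continuous (F n)) ∧
    ∀ x, Tendsto (fun n => F n x) atTop (𝓝 (f x))

/-- The space `B₁(X)` of functions of Baire class 1. As a subtype of `X → ℝ`, it carries the
topology of pointwise convergence. -/
abbrev BaireOne (X : Type*) [TopologicalSpace X] : Type _ :=
  {f : X → ℝ // IsBaireOne f}

/-- A Rosenthal compactum is a compact Hausdorff space that embeds in `B₁(X)` for some Polish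
space `X`. (A Polish space has at most continuum many points, so that up to homeomorphism it
lives in `Type`, and nothing is lost by taking `X` there.) -/
def IsRosenthalCompactum (K : Type*) [TopologicalSpace K] : Prop :=
  CompactSpace K ∧ T2Space K ∧
    ∃ (X : Type) (_ : TopologicalSpace X), PolishSpace X ∧
      ∃ e : K → BaireOne X, IsEmbedding e

/-! ### Types over parameter sets and monster models -/

namespace ModelTypes

universe u v w

variable (L : FirstOrder.Language.{u, v}) {U : Type w} [L.Structure U] [Nonempty U]

/-- The Stone space `S_y(A)` of complete types over `A ⊆ U` in the tuple of variables `β`: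
maximal consistent sets of formulas over `A` containing the theory of `U` with constants for `A`,
with Mathlib's topology, generated by the sets of types which contain a given formula. -/
abbrev TypesOver (A : Set U) (β : Type*) : Type _ :=
  (L[[A]].completeTheory U).CompleteType β

/-- The type `tp(b/A)` of a tuple `b`. -/
noncomputable abbrev tp (A : Set U) {β : Type*} (b : β → U) : TypesOver L A β :=
  (L[[A]].completeTheory U).typeOf b

variable (U) in
/-- `U` is `κ`-saturated: every type in finitely many variables over fewer than `κ` parameters
is realized in `U`. -/
def IsSaturated (κ : Cardinal.{w}) : Prop :=
  ∀ A : Set U, #A < κ → ∀ (n : ℕ) (q : TypesOver L A (Fin n)), ∃ b : Fin n → U, tp L A b = q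

variable (U) in
/-- `U` is strongly `κ`-homogeneous: every elementary map from a subset of `U` with fewer than
`κ` elements to `U` extends to an automorphism of `U`. -/
def IsStronglyHomogeneous (κ : Cardinal.{w}) : Prop :=
  ∀ A : Set U, #A < κ → ∀ f : A → U,
    (∀ ψ : L.Formula A, ψ.Realize f ↔ ψ.Realize (fun a : A => (a : U))) →
      ∃ σ : U ≃[L] U, ∀ a : A, σ (a : U) = f a

variable (U) in
/-- `U` is a monster model with respect to `κ`: it is `κ`-saturated and strongly
`κ`-homogeneous. -/
def IsMonster (κ : Cardinal.{w}) : Prop :=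
  IsSaturated L U κ ∧ IsStronglyHomogeneous L U κ

end ModelTypes

/-! ### Local types of a formula `φ(x;y)`, with `x` indexed by `α` and `y` indexed by `β` -/

namespace ModelTypes

variable {L : FirstOrder.Language} {α β U : Type*} [L.Structure U]

variable (U) in
/-- `φ(x;y)` is NIP (in `U`): there is no infinite set `A` of `x`-tuples with `y`-tuples `b I`,
for `I ⊆ A`, such that for `a ∈ A`, `φ(a; b I)` holds if and only if `a ∈ I`. -/
def IsNIP (φ : L.Formula (α ⊕ β)) : Prop :=
  ¬ ∃ A : Set (α → U), A.Infinite ∧ ∃ b : Set (α → U) → (β → U),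
    ∀ I ⊆ A, ∀ a ∈ A, φ.Realize (Sum.elim a (b I)) ↔ a ∈ I

/-- The instance `φ(x;b)`, a formula in `x` with parameters in `U`. -/
def inst (φ : L.Formula (α ⊕ β)) (b : β → U) : L[[U]].Formula α :=
  BoundedFormula.constantsVarsEquiv.symm (φ.relabel (Sum.elim Sum.inr (Sum.inl ∘ b)))

theorem realize_inst (φ : L.Formula (α ⊕ β)) (b : β → U) (a : α → U) :
    (inst φ b).Realize a ↔ φ.Realize (Sum.elim a b) := by
  unfold inst Formula.Realize
  rw [← BoundedFormula.realize_constantsVarsEquiv, Equiv.apply_symm_apply]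
  refine (Formula.realize_relabel (φ := φ)).trans (iff_of_eq (congrArg φ.Realize ?_))
  funext x
  cases x <;> rfl

variable (U) in
/-- A (complete) `φ`-type over `U`: a set of formulas of the form `φ(x;b)` or `¬φ(x;b)` which is
consistent, that is, finitely satisfiable in `U`, and which decides each `φ(x;b)`. -/
structure LocalType (φ : L.Formula (α ⊕ β)) where
  /-- the formulas of the type -/
  formulas : Set (L[[U]].Formula α)
  isInstance : ∀ ψ ∈ formulas, ∃ b : β → U, ψ = inst φ b ∨ ψ = ∼(inst φ b)
  consistent : ∀ s : Finset (L[[U]].Formula α), (s : Set (L[[U]].Formula α)) ⊆ formulas →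
    ∃ a : α → U, ∀ ψ ∈ s, ψ.Realize a
  complete : ∀ b : β → U, inst φ b ∈ formulas ∨ ∼(inst φ b) ∈ formulas

/-- The topology of `S_φ(U)`, generated by the sets of types containing a given instance of `φ`
or of `¬φ`. -/
instance (φ : L.Formula (α ⊕ β)) : TopologicalSpace (LocalType U φ) :=
  TopologicalSpace.generateFrom
    {s | ∃ b : β → U, s = {p | inst φ b ∈ p.formulas} ∨ s = {p | ∼(inst φ b) ∈ p.formulas}}

/-- `p` is invariant over `A`, that is, under all automorphisms of `U` that fix `A` pointwise. -/
def LocalType.IsInvariant {φ : L.Formula (α ⊕ β)} (p : LocalType U φ) (A : Set U) : Prop :=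
  ∀ σ : U ≃[L] U, (∀ m ∈ A, σ m = m) →
    ∀ b : β → U, inst φ b ∈ p.formulas ↔ inst φ (σ ∘ b) ∈ p.formulas

/-- The space `Inv_φ(A)` of `A`-invariant `φ`-types over `U`, a subspace of `S_φ(U)`. -/
abbrev Inv (φ : L.Formula (α ⊕ β)) (A : Set U) : Type _ :=
  {p : LocalType U φ // p.IsInvariant A}

open scoped Classical in
/-- The function `d_p : S_y(A) → {0, 1}`, with value `1` at `q` if `φ(x;b)` is in `p` for some
realization `b` of `q` in `U`, and `0` otherwise. -/
noncomputable def dFun [Nonempty U] {φ : L.Formula (α ⊕ β)} {A : Set U} (p : Inv φ A)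
    (q : TypesOver L A β) : ℝ :=
  if ∃ b : β → U, tp L A b = q ∧ inst φ b ∈ p.1.formulas then 1 else 0

end ModelTypes

/-! By saturation and homogeneity, an $M$-invariant $p$ is determined by the set $s$ of types $q$
over $M$ whose realizations $b$ satisfy $\phi(x;b)\in p$, and $d_p$ is the indicator of $s$. So
$p\mapsto d_p$ is injective and continuous on a compact space, hence an embedding once its values
are known to lie in $B_1$.

Baire class 1 holds when $s$ and its complement are $F_\sigma$. If this fails, `isFSigma_and_compl`
gives a nonempty closed $F$ in which both $s$ and its complement are dense. On such an $F$
arbitrarily large finite sets of $x$-tuples can be shattered by realizations of every $q\in F$. To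
add a tuple (`ShatteredOver.exists_insert`), realize $p$ over countably many realizations of types
dense in both halves of $F$. A prescribed pattern is then realized at a dense set of types, and at
all of $F$, because in a saturated model the types of the points of a definable set form a closed
set (`IsSaturated.isClosed_image_tp`). The union of the finite sets is infinite, and saturation
shatters it, contradicting NIP. -/

/-! ### Closure properties of $F_\sigma$ sets -/

/-- A set is `F_σ` if it is a countable union of closed sets. -/
def IsFSigma {X : Type*} [TopologicalSpace X] (s : Set X) : Prop :=
  ∃ K : ℕ → Set X, (∀ n, IsClosed (K n)) ∧ s = ⋃ n, K n

namespace IsFSigma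

variable {X : Type*} [TopologicalSpace X]

theorem of_isClosed {s : Set X} (hs : IsClosed s) : IsFSigma s :=
  ⟨fun _ => s, fun _ => hs, (iUnion_const s).symm⟩

theorem iUnion {ι : Type*} [Countable ι] {s : ι → Set X} (hs : ∀ i, IsFSigma (s i)) :
    IsFSigma (⋃ i, s i) := by
  choose K hK hs using hs
  rcases isEmpty_or_nonempty ι with _ | _
  · simpa using of_isClosed (X := X) isClosed_empty
  obtain ⟨e, he⟩ := exists_surjective_nat (ι × ℕ)
  refine ⟨fun n => K (e n).1 (e n).2, fun n => hK _ _, ?_⟩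
  rw [he.iUnion_comp (fun p : ι × ℕ => K p.1 p.2), iUnion_prod']
  simp [hs]

theorem union {s t : Set X} (hs : IsFSigma s) (ht : IsFSigma t) : IsFSigma (s ∪ t) := by
  rw [union_eq_iUnion]
  exact iUnion (by rintro (_ | _) <;> assumption)

theorem inter_isClosed {s t : Set X} (hs : IsFSigma s) (ht : IsClosed t) : IsFSigma (s ∩ t) := by
  obtain ⟨K, hK, rfl⟩ := hs
  exact ⟨fun n => K n ∩ t, fun n => (hK n).inter ht, iUnion_inter _ _⟩

theorem inter {s t : Set X} (hs : IsFSigma s) (ht : IsFSigma t) : IsFSigma (s ∩ t) := by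
  obtain ⟨K, hK, rfl⟩ := ht
  rw [inter_iUnion]
  exact iUnion fun n => hs.inter_isClosed (hK n)

theorem of_isOpen [TopologicalSpace.PseudoMetrizableSpace X] {s : Set X} (hs : IsOpen s) :
    IsFSigma s := by
  let _ := TopologicalSpace.pseudoMetrizableSpacePseudoMetric X
  obtain ⟨K, hK, -, h, -⟩ := hs.exists_iUnion_isClosed
  exact ⟨K, hK, h.symm⟩

theorem exists_monotone {s : Set X} (hs : IsFSigma s) :
    ∃ K : ℕ → Set X, (∀ n, IsClosed (K n)) ∧ Monotone K ∧ s = ⋃ n, K n := by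
  obtain ⟨K, hK, rfl⟩ := hs
  exact ⟨Set.accumulate K, fun n => (Set.finite_Iic n).isClosed_biUnion fun i _ => hK i,
    monotone_accumulate, iUnion_accumulate.symm⟩

end IsFSigma

/-! ### Indicators of Baire class 1 and Rosenthal compacta -/

section BaireOne

variable {X : Type*} [TopologicalSpace X]

/-- The indicator of a set which is `F_σ` together with its complement is of Baire class 1. -/
theorem isBaireOne_indicator [NormalSpace X] {s : Set X} (hs : IsFSigma s)
    (hs' : IsFSigma sᶜ) : IsBaireOne (s.indicator (1 : X → ℝ)) := by
  obtain ⟨K, hK, hKm, hKs⟩ := hs.exists_monotone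
  obtain ⟨H, hH, hHm, hHs⟩ := hs'.exists_monotone
  have hd : ∀ n, Disjoint (H n) (K n) := fun n =>
    (disjoint_compl_left (a := s)).mono (hHs ▸ subset_iUnion H n) (hKs ▸ subset_iUnion K n)
  -- Urysohn functions, 0 on `H n` and 1 on `K n`. Both sequences increase, so at each point the
  -- values are eventually constant.
  choose F hF0 hF1 _ using fun n => exists_continuous_zero_one_of_isClosed (hH n) (hK n) (hd n)
  refine ⟨fun n => F n, fun n => (F n).continuous, fun x => ?_⟩
  by_cases hx : x ∈ s
  · rw [indicator_of_mem hx]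
    obtain ⟨n, hn⟩ := mem_iUnion.1 (hKs ▸ hx)
    exact tendsto_const_nhds.congr' ((eventually_ge_atTop n).mono fun m hm =>
      (hF1 m (hKm hm hn)).symm)
  · rw [indicator_of_notMem hx]
    obtain ⟨n, hn⟩ := mem_iUnion.1 (hHs ▸ (show x ∈ sᶜ from hx))
    exact tendsto_const_nhds.congr' ((eventually_ge_atTop n).mono fun m hm =>
      (hF0 m (hHm hm hn)).symm)

/-- If no nonempty closed set `F` is contained both in the closure of `F ∩ s` and in that of
`F \ s`, then `s` and its complement are `F_σ`. -/
theorem isFSigma_and_compl [SecondCountableTopology X]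
    [TopologicalSpace.PseudoMetrizableSpace X] {s : Set X}
    (h : ∀ F : Set X, IsClosed F → F ⊆ closure (F ∩ s) → F ⊆ closure (F ∩ sᶜ) → F = ∅) :
    IsFSigma s ∧ IsFSigma sᶜ := by
  let B := TopologicalSpace.countableBasis X
  have hB : TopologicalSpace.IsTopologicalBasis B := TopologicalSpace.isBasis_countableBasis X
  -- The union `V` of these basic sets is the largest open set on which the conclusion holds
  -- locally; its complement will play the role of $F$.
  let G : Set (Set X) := {u ∈ B | IsFSigma (u ∩ s) ∧ IsFSigma (u ∩ sᶜ)}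
  have : Countable G :=
    ((TopologicalSpace.countable_countableBasis X).mono fun u hu => hu.1).to_subtype
  let V : Set X := ⋃₀ G
  have hV : IsOpen V := isOpen_sUnion fun u hu => hB.isOpen hu.1
  have hVs : ∀ t : Set X, (∀ u ∈ G, IsFSigma (u ∩ t)) → IsFSigma (V ∩ t) := fun t ht => by
    have hVt : V ∩ t = ⋃ u : G, (u : Set X) ∩ t := by
      rw [← iUnion_inter, ← sUnion_eq_iUnion]
    rw [hVt]
    exact IsFSigma.iUnion fun u => ht u u.2
  have h1 := hVs s fun u hu => hu.2.1
  have h2 := hVs sᶜ fun u hu => hu.2.2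
  -- If a basic neighbourhood `u` of a point outside `V` missed `Vᶜ ∩ t`, then `u ∩ t` would lie in
  -- `V`, so both traces on `u` would be $F_\sigma$ and `u` would belong to `G`.
  have key : ∀ t : Set X, IsFSigma (V ∩ t) → IsFSigma (V ∩ tᶜ) → (t = s ∨ t = sᶜ) →
      Vᶜ ⊆ closure (Vᶜ ∩ t) := by
    intro t ht ht' hts x hx
    by_contra hc
    obtain ⟨u, hu, hxu, huc⟩ := hB.exists_subset_of_mem_open (u := (closure (Vᶜ ∩ t))ᶜ) hc
      isClosed_closure.isOpen_compl
    have hut : ∀ y ∈ u, y ∈ t → y ∈ V := fun y hy hyt => by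
      by_contra hyV
      exact huc hy (subset_closure ⟨hyV, hyt⟩)
    have huo : IsFSigma u := IsFSigma.of_isOpen (hB.isOpen hu)
    have e1 : IsFSigma (u ∩ t) := by
      have : u ∩ t = u ∩ (V ∩ t) := by
        ext y; exact ⟨fun hy => ⟨hy.1, hut y hy.1 hy.2, hy.2⟩, fun hy => ⟨hy.1, hy.2.2⟩⟩
      rw [this]
      exact huo.inter ht
    have e2 : IsFSigma (u ∩ tᶜ) := by
      have : u ∩ tᶜ = (u ∩ (V ∩ tᶜ)) ∪ (u ∩ Vᶜ) := by
        ext y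
        have := hut y
        simp only [mem_inter_iff, mem_union, mem_compl_iff]
        tauto
      rw [this]
      exact (huo.inter ht').union (huo.inter_isClosed hV.isClosed_compl)
    refine hx (mem_sUnion_of_mem hxu ⟨hu, ?_⟩)
    rcases hts with rfl | rfl
    · exact ⟨e1, e2⟩
    · exact ⟨by simpa using e2, e1⟩
  have hVu : V = Set.univ := compl_empty_iff.1 (h Vᶜ hV.isClosed_compl
    (key s h1 h2 (Or.inl rfl)) (key sᶜ h2 (by simpa using h1) (Or.inr rfl)))
  rw [hVu, univ_inter] at h1 h2
  exact ⟨h1, h2⟩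

/-- Baire class 1 is preserved by composition with a continuous map. -/
theorem IsBaireOne.comp {Y : Type*} [TopologicalSpace Y] {f : X → ℝ} (hf : IsBaireOne f)
    {g : Y → X} (hg : Continuous g) : IsBaireOne (f ∘ g) := by
  obtain ⟨F, hF, h⟩ := hf
  exact ⟨fun n => F n ∘ g, fun n => (hF n).comp hg, fun y => h (g y)⟩

/-- A compact space that embeds in `B₁(X)` for a compact Polish space `X` in any universe is a
Rosenthal compactum. -/
theorem isRosenthalCompactum_of_isEmbedding {K : Type*} [TopologicalSpace K] [CompactSpace K]
    [CompactSpace X] [PolishSpace X] {e : K → BaireOne X} (he : IsEmbedding e) :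
    IsRosenthalCompactum K := by
  -- The image in $\ell^\infty$ is a copy of `X` in `Type`.
  obtain ⟨j, hj⟩ := TopologicalSpace.exists_embedding_l_infty X
  let h : X ≃ₜ range j := hj.toHomeomorph
  have : CompactSpace (range j) := isCompact_iff_compactSpace.1 (isCompact_range hj.continuous)
  have : T2Space K := he.t2Space
  refine ⟨inferInstance, inferInstance, range j, inferInstance,
    h.symm.isClosedEmbedding.polishSpace,
    fun k => ⟨(e k).1 ∘ h.symm, (e k).2.comp h.symm.continuous⟩, ?_⟩
  refine (Continuous.isClosedEmbedding ?_ ?_).isEmbedding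
  · refine Continuous.subtype_mk (continuous_pi fun y => ?_) _
    exact (continuous_apply (h.symm y)).comp (continuous_subtype_val.comp he.continuous)
  · intro k k' hk
    refine he.injective (Subtype.ext (funext fun x => ?_))
    have := congrFun (congrArg Subtype.val hk) (h x)
    simpa using this

end BaireOne

/-! ### Type spaces in saturated and homogeneous structures -/

namespace ModelTypes

universe u v w

variable {L : FirstOrder.Language.{u, v}} {U : Type w} [L.Structure U]

theorem countable_formula {L : FirstOrder.Language.{u, v}} (hL : L.card ≤ ℵ₀) {γ : Type*}
    [Countable γ] : Countable (L.Formula γ) := by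
  have h : Countable (Σ n, L.BoundedFormula γ n) := by
    refine mk_le_aleph0_iff.1 (BoundedFormula.card_le.trans (max_le le_rfl ?_))
    simp only [add_le_aleph0, lift_le_aleph0, mk_le_aleph0_iff]
    exact ⟨inferInstance, hL⟩
  exact (sigma_mk_injective (i := 0)).countable

/-- The Stone space is compact Hausdorff, and countably many sentences give a countable base, so it
is metrizable. -/
theorem polishSpace_typesOver (hL : L.card ≤ ℵ₀) (A : Set U) [Countable A] {β : Type*}
    [Finite β] : PolishSpace (TypesOver L A β) := by
  have : Countable L[[A]][[β]].Sentence := by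
    refine countable_formula ?_
    simp only [card_withConstants, add_le_aleph0, lift_le_aleph0, mk_le_aleph0_iff]
    exact ⟨⟨hL, inferInstance⟩, inferInstance⟩
  have : SecondCountableTopology (TypesOver L A β) :=
    CompleteType.isTopologicalBasis_range_typesWith.secondCountableTopology
      (countable_range _)
  let _ := TopologicalSpace.metrizableSpaceMetric (TypesOver L A β)
  infer_instance

variable [Nonempty U]

/-- The formulas of a type pull back to definable sets of tuples. -/
theorem definable_tp_preimage {β : Type*} (A : Set U) (ψ : L[[A]][[β]].Sentence) :
    A.Definable L (tp L A ⁻¹' (L[[A]].completeTheory U).typesWith (α := β) ψ) :=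
  ⟨Formula.equivSentence.symm ψ, by
    ext v
    exact Theory.CompleteType.mem_typeOf (T := L[[A]].completeTheory U)⟩

theorem exists_preimage_typesWith_of_definable {β : Type*} {A : Set U} {s : Set (β → U)}
    (hs : A.Definable L s) :
    ∃ ψ : L[[A]][[β]].Sentence, s = tp L A ⁻¹' (L[[A]].completeTheory U).typesWith ψ := by
  obtain ⟨ψ, rfl⟩ := hs
  refine ⟨Formula.equivSentence ψ, ?_⟩
  ext v
  exact (Theory.CompleteType.formula_mem_typeOf (T := L[[A]].completeTheory U)).symm

theorem mem_iff_of_tp_eq {β : Type*} {A : Set U} {s : Set (β → U)} (hs : A.Definable L s)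
    {b c : β → U} (h : tp L A b = tp L A c) : b ∈ s ↔ c ∈ s := by
  obtain ⟨ψ, rfl⟩ := exists_preimage_typesWith_of_definable hs
  rw [mem_preimage, mem_preimage, h]

/-- In a saturated structure, a family of sets definable over few parameters which has the finite
intersection property has nonempty intersection. -/
theorem IsSaturated.nonempty_iInter {κ : Cardinal.{w}} (hU : IsSaturated L U κ) {A : Set U}
    (hA : #A < κ) {γ ι : Type*} [Finite γ] {s : ι → Set (γ → U)}
    (hs : ∀ i, A.Definable L (s i)) (hfin : ∀ t : Finset ι, (⋂ i ∈ t, s i).Nonempty) :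
    (⋂ i, s i).Nonempty := by
  obtain ⟨n, ⟨e⟩⟩ := Finite.exists_equiv_fin γ
  choose ψ hψ using fun i => exists_preimage_typesWith_of_definable ((hs i).preimage_comp e)
  obtain ⟨q, hq⟩ := CompactSpace.iInter_nonempty
    (t := fun i => (L[[A]].completeTheory U).typesWith (ψ i))
    (fun i => CompleteType.isClosed_typesWith _) fun t => by
      obtain ⟨a, ha⟩ := hfin t
      refine ⟨tp L A (a ∘ e.symm), mem_iInter₂.2 fun i hi => ?_⟩
      rw [← mem_preimage, ← hψ i, mem_preimage, Function.comp_assoc, e.symm_comp_self,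
        Function.comp_id]
      exact mem_iInter₂.1 ha i hi
  obtain ⟨b, rfl⟩ := hU A hA n q
  refine ⟨b ∘ e, mem_iInter.2 fun i => ?_⟩
  rw [← mem_preimage (f := fun g : Fin n → U => g ∘ e), hψ i]
  exact mem_iInter.1 hq i

/-- A formula in some type is satisfiable in a model of the complete theory of `U` over `A`, so its
existential closure is true in `U`. No saturation is needed. -/
theorem denseRange_tp {β : Type*} [Finite β] (A : Set U) :
    DenseRange (tp L A : (β → U) → TypesOver L A β) := by
  rw [DenseRange, CompleteType.isTopologicalBasis_range_typesWith.dense_iff]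
  rintro _ ⟨ψ, rfl⟩ ⟨q, hq⟩
  obtain ⟨N, v, rfl⟩ := Theory.exists_modelType_is_realized_in _ q
  have hv : (Formula.equivSentence.symm ψ).Realize v := Theory.CompleteType.mem_typeOf.1 hq
  let θ : L[[A]].Sentence :=
    ((Formula.equivSentence.symm ψ).relabel (Sum.inr : β → Empty ⊕ β)).iExs β
  have hN : N ⊨ θ := Formula.realize_iExs.2 ⟨v, by
    rw [Formula.realize_relabel]; exact hv⟩
  have hU : U ⊨ θ :=
    ((completeTheory.isComplete L[[A]] U).realize_sentence_iff θ U).2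
      (((completeTheory.isComplete L[[A]] U).realize_sentence_iff θ N).1 hN)
  obtain ⟨w, hw⟩ := Formula.realize_iExs.1 hU
  rw [Formula.realize_relabel] at hw
  exact ⟨tp L A w, Theory.CompleteType.mem_typeOf.2 hw, w, rfl⟩

/-- In a saturated structure, the types over a small set of the elements of a set which is
definable over a small set form a closed set. -/
theorem IsSaturated.isClosed_image_tp {κ : Cardinal.{w}} (hU : IsSaturated L U κ) {A C : Set U}
    (hAC : #(A ∪ C : Set U) < κ) {β : Type*} [Finite β] {W : Set (β → U)}
    (hW : C.Definable L W) : IsClosed (tp L A '' W) := by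
  refine isClosed_of_closure_subset fun q hq => ?_
  -- The index `none` stands for `W`, the others for the formulas of `q`; a common point is an
  -- element of `W` realizing `q`.
  let s : Option {ψ : L[[A]][[β]].Sentence // ψ ∈ q} → Set (β → U) := fun i =>
    i.elim W fun ψ => tp L A ⁻¹' (L[[A]].completeTheory U).typesWith ψ.1
  obtain ⟨c, hc⟩ := hU.nonempty_iInter (s := s) hAC (by
    rintro (_ | ψ)
    · exact hW.mono subset_union_right
    · exact (definable_tp_preimage A ψ.1).mono subset_union_left) fun t => by
      have ho : IsOpen (⋂ ψ ∈ t.eraseNone, (L[[A]].completeTheory U).typesWith ψ.1) :=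
        isOpen_biInter_finset fun ψ _ => CompleteType.isOpen_typesWith _
      obtain ⟨_, hr, c, hcW, rfl⟩ :=
        mem_closure_iff.1 hq _ ho (mem_iInter₂.2 fun ψ _ => ψ.2)
      refine ⟨c, mem_iInter₂.2 ?_⟩
      rintro (_ | ψ) hψ
      · exact hcW
      · exact mem_iInter₂.1 hr ψ (Finset.mem_eraseNone.2 hψ)
  rw [mem_iInter] at hc
  refine ⟨c, hc none, SetLike.ext fun ψ => ⟨fun h => ?_, fun h => hc (some ⟨ψ, h⟩)⟩⟩
  by_contra hψ
  rw [← Theory.CompleteType.not_mem_iff] at hψ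
  exact (Theory.CompleteType.not_mem_iff _ _).1 (hc (some ⟨_, hψ⟩)) h

/-- The set of realized types is dense, and closed as the image of the definable set of all tuples.
-/
theorem IsSaturated.surjective_tp {κ : Cardinal.{w}} (hU : IsSaturated L U κ) {A : Set U}
    (hA : #A < κ) {β : Type*} [Finite β] :
    Function.Surjective (tp L A : (β → U) → TypesOver L A β) := by
  have h := hU.isClosed_image_tp (A := A) (C := ∅) (W := (Set.univ : Set (β → U)))
    (by rwa [union_empty]) definable_univ
  rw [image_univ] at h
  exact range_eq_univ.1 (h.closure_eq ▸ (denseRange_tp A).closure_eq)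

/-- Tuples with the same type over a small set are conjugate. -/
theorem IsStronglyHomogeneous.exists_equiv {κ : Cardinal.{w}} (hU : IsStronglyHomogeneous L U κ)
    (hκ : ℵ₀ ≤ κ) {A : Set U} (hA : #A < κ) {β : Type*} [Finite β] {b c : β → U}
    (h : tp L A b = tp L A c) : ∃ σ : U ≃[L] U, (∀ a ∈ A, σ a = a) ∧ σ ∘ b = c := by
  classical
  have key : ∀ ψ : L.Formula (A ⊕ β),
      ψ.Realize (Sum.elim (↑) b) ↔ ψ.Realize (Sum.elim (↑) c) := fun ψ =>
    mem_iff_of_tp_eq (s := {v : β → U | ψ.Realize (Sum.elim (fun a : A => (a : U)) v)})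
      (definable_iff_exists_formula_sum.2 ⟨ψ, rfl⟩) h
  -- Equality is a formula, so sending `b` to `c` and fixing `A` is a well-defined map on `A ∪ range
  -- b`.
  have keq : ∀ x y : A ⊕ β, (Sum.elim (↑) b x : U) = Sum.elim (↑) b y →
      (Sum.elim (↑) c x : U) = Sum.elim (↑) c y := fun x y hxy => by
    have := key ((Term.var x).equal (Term.var y))
    simp only [Formula.realize_equal, Term.realize_var] at this
    exact this.1 hxy
  let A' : Set U := range (Sum.elim (↑) b : A ⊕ β → U)
  have hA' : #A' < κ := by
    have : A' = A ∪ range b := by simp [A', Sum.elim_range]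
    rw [this]
    exact (mk_union_le _ _).trans_lt (add_lt_of_lt hκ hA
      ((lt_aleph0_of_finite _).trans_le hκ))
  choose g hg using fun u : A' => u.2
  obtain ⟨σ, hσ⟩ := hU A' hA' (Sum.elim (↑) c ∘ g) fun ψ => by
    have := key (ψ.relabel g)
    rw [Formula.realize_relabel, Formula.realize_relabel] at this
    rw [← this]
    exact iff_of_eq (congrArg ψ.Realize (funext hg))
  have hσ' : ∀ x : A ⊕ β, σ (Sum.elim (↑) b x : U) = Sum.elim (↑) c x := fun x => by
    rw [hσ ⟨_, mem_range_self x⟩]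
    exact keq _ _ (hg ⟨_, mem_range_self x⟩)
  exact ⟨σ, fun a ha => hσ' (Sum.inl ⟨a, ha⟩), funext fun i => hσ' (Sum.inr i)⟩

end ModelTypes

/-! ### Compactness of the space of invariant local types -/

namespace ModelTypes

variable {L : FirstOrder.Language} {α β U : Type*} [L.Structure U]

namespace LocalType

variable {φ : L.Formula (α ⊕ β)}

theorem not_inst_mem_iff (p : LocalType U φ) (b : β → U) :
    ∼(inst φ b) ∈ p.formulas ↔ inst φ b ∉ p.formulas := by
  classical
  refine ⟨fun h h' => ?_, (p.complete b).resolve_left⟩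
  obtain ⟨a, ha⟩ := p.consistent {inst φ b, ∼(inst φ b)} (by
    simp [Set.insert_subset_iff, h, h'])
  exact Formula.realize_not.1 (ha (∼(inst φ b)) (by simp)) (ha (inst φ b) (by simp))

/-- A `φ`-type is determined by the instances of `φ` in it. -/
theorem ext_inst {p q : LocalType U φ}
    (h : ∀ b : β → U, inst φ b ∈ p.formulas ↔ inst φ b ∈ q.formulas) : p = q := by
  have hpq : p.formulas = q.formulas := by
    have key : ∀ p q : LocalType U φ,
        (∀ b : β → U, inst φ b ∈ p.formulas ↔ inst φ b ∈ q.formulas) →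
        p.formulas ⊆ q.formulas := by
      intro p q h ψ hψ
      obtain ⟨b, rfl | rfl⟩ := p.isInstance ψ hψ
      · exact (h b).1 hψ
      · rwa [not_inst_mem_iff, ← h, ← not_inst_mem_iff]
    exact (key p q h).antisymm (key q p fun b => (h b).symm)
  cases p; cases q; cases hpq; rfl

theorem isClopen_inst_mem (b : β → U) : IsClopen {p : LocalType U φ | inst φ b ∈ p.formulas} := by
  refine ⟨⟨?_⟩, TopologicalSpace.isOpen_generateFrom_of_mem ⟨b, Or.inl rfl⟩⟩
  refine TopologicalSpace.isOpen_generateFrom_of_mem ⟨b, Or.inr ?_⟩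
  ext p
  exact (p.not_inst_mem_iff b).symm

/-- The limit of an ultrafilter on the space of `φ`-types. -/
def lim (F : Ultrafilter (LocalType U φ)) : LocalType U φ where
  formulas := {ψ | ∀ᶠ p : LocalType U φ in F, ψ ∈ p.formulas}
  isInstance ψ hψ := by
    obtain ⟨p, hp⟩ := hψ.exists
    exact p.isInstance ψ hp
  consistent s hs := by
    obtain ⟨p, hp⟩ := ((s.eventually_all).2 hs).exists
    exact p.consistent s hp
  complete b := Ultrafilter.eventually_or.1 (Eventually.of_forall fun p => p.complete b)

theorem le_nhds_lim (F : Ultrafilter (LocalType U φ)) : (F : Filter _) ≤ 𝓝 (lim F) := by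
  refine TopologicalSpace.tendsto_nhds_generateFrom_iff (f := (F : Filter (LocalType U φ))) (m := id).2 ?_
  rintro _ ⟨b, rfl | rfl⟩ h
  · exact h
  · exact h

theorem isClosed_setOf_isInvariant (A : Set U) :
    IsClosed {p : LocalType U φ | p.IsInvariant A} := by
  simp only [IsInvariant, ofPred_forall]
  refine isClosed_iInter fun σ => isClosed_iInter fun _ => isClosed_iInter fun b => ?_
  have : {p : LocalType U φ | inst φ b ∈ p.formulas ↔ inst φ (σ ∘ b) ∈ p.formulas} =
      ({p | inst φ b ∈ p.formulas} ∩ {p | inst φ (σ ∘ b) ∈ p.formulas}) ∪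
      ({p | inst φ b ∈ p.formulas}ᶜ ∩ {p | inst φ (σ ∘ b) ∈ p.formulas}ᶜ) := by
    ext p
    exact iff_iff_and_or_not_and_not
  rw [this]
  exact (((isClopen_inst_mem b).inter (isClopen_inst_mem _)).union
    ((isClopen_inst_mem b).compl.inter (isClopen_inst_mem _).compl)).1

instance : CompactSpace (LocalType U φ) :=
  ⟨isCompact_iff_ultrafilter_le_nhds.2 fun F _ => ⟨lim F, mem_univ _, le_nhds_lim F⟩⟩

end LocalType

instance (φ : L.Formula (α ⊕ β)) (A : Set U) : CompactSpace (Inv φ A) :=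
  isCompact_iff_compactSpace.1 (LocalType.isClosed_setOf_isInvariant A).isCompact

end ModelTypes

/-! ### Shattering, NIP and the functions $d_p$ -/

namespace ModelTypes

universe w

variable {L : FirstOrder.Language} {U : Type w} [L.Structure U] {α β : Type*}

theorem definable_setOf_realize_right (φ : L.Formula (α ⊕ β)) {C : Set U} {a : α → U}
    (ha : range a ⊆ C) (v : Prop) :
    C.Definable L {c : β → U | φ.Realize (Sum.elim a c) ↔ v} := by
  have h : C.Definable L {c : β → U | φ.Realize (Sum.elim a c)} := by
    refine definable_iff_exists_formula_sum.2
      ⟨φ.relabel (Sum.map (fun i => ⟨a i, ha (mem_range_self i)⟩) id), ?_⟩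
    ext c
    simp only [mem_ofPred_eq, Formula.realize_relabel]
    refine iff_of_eq (congrArg φ.Realize ?_)
    funext x
    cases x <;> rfl
  by_cases hv : v
  · simpa [hv] using h
  · simp only [hv, iff_false]
    exact h.compl

theorem definable_setOf_realize_left (φ : L.Formula (α ⊕ β)) {C : Set U} {b : β → U}
    (hb : range b ⊆ C) (v : Prop) :
    C.Definable L {a : α → U | φ.Realize (Sum.elim a b) ↔ v} := by
  have := definable_setOf_realize_right (φ.relabel Sum.swap) hb v
  simp only [Formula.realize_relabel] at this
  convert this using 5
  funext x
  rename_i x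
  cases x <;> rfl

theorem mk_lt_of_countable {κ : Cardinal.{w}} (hκ : ℵ₀ < κ) {A : Set U} (hA : A.Countable) :
    #A < κ :=
  (mk_le_aleph0_iff.2 hA.to_subtype).trans_lt hκ

variable [Nonempty U]

/-- A `φ`-type is realized over countably many tuples. -/
theorem LocalType.exists_realize {φ : L.Formula (α ⊕ β)} (p : LocalType U φ) {κ : Cardinal.{w}}
    (hκ : ℵ₀ < κ) (hU : IsSaturated L U κ) [Finite α] [Finite β] {B : Set (β → U)}
    (hB : B.Countable) :
    ∃ a : α → U, ∀ b ∈ B, φ.Realize (Sum.elim a b) ↔ inst φ b ∈ p.formulas := by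
  classical
  let C : Set U := ⋃ b ∈ B, range b
  have hC : C.Countable := hB.biUnion fun b _ => countable_range b
  obtain ⟨a, ha⟩ := hU.nonempty_iInter (mk_lt_of_countable hκ hC)
    (s := fun b : B => {a : α → U | φ.Realize (Sum.elim a b) ↔ inst φ b ∈ p.formulas})
    (fun b => definable_setOf_realize_left φ (subset_biUnion_of_mem (u := range) b.2) _)
    fun t => by
      obtain ⟨a, ha⟩ := p.consistent
        (t.image fun b : B => if inst φ b ∈ p.formulas then inst φ b else ∼(inst φ b)) (by
          intro ψ hψ
          obtain ⟨b, -, rfl⟩ := Finset.mem_image.1 hψ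
          split_ifs with h
          · exact h
          · exact (p.not_inst_mem_iff _).2 h)
      refine ⟨a, mem_iInter₂.2 fun b hb => ?_⟩
      have := ha _ (Finset.mem_image_of_mem _ hb)
      rw [mem_ofPred_eq, ← realize_inst]
      split_ifs at this with h
      · exact iff_of_true this h
      · exact iff_of_false (Formula.realize_not.1 this) h
  rw [mem_iInter] at ha
  exact ⟨a, fun b hb => ha ⟨b, hb⟩⟩

/-- For an invariant type, `φ(x;b) ∈ p` depends only on the type of `b`. -/
theorem Inv.inst_mem_iff_of_tp_eq {φ : L.Formula (α ⊕ β)} {A : Set U} (p : Inv φ A)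
    {κ : Cardinal.{w}} (hκ : ℵ₀ < κ) (hU : IsStronglyHomogeneous L U κ) (hA : A.Countable)
    [Finite β] {b c : β → U} (h : tp L A b = tp L A c) :
    inst φ b ∈ p.1.formulas ↔ inst φ c ∈ p.1.formulas := by
  obtain ⟨σ, hσ, rfl⟩ := hU.exists_equiv hκ.le (mk_lt_of_countable hκ hA) h
  exact p.2 σ hσ b

theorem dFun_tp {φ : L.Formula (α ⊕ β)} {A : Set U} (p : Inv φ A)
    {κ : Cardinal.{w}} (hκ : ℵ₀ < κ) (hU : IsStronglyHomogeneous L U κ) (hA : A.Countable)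
    [Finite β] (b : β → U) [Decidable (inst φ b ∈ p.1.formulas)] :
    dFun p (tp L A b) = if inst φ b ∈ p.1.formulas then 1 else 0 := by
  unfold dFun
  congr 1
  exact propext ⟨fun ⟨c, hc, h⟩ => (p.inst_mem_iff_of_tp_eq hκ hU hA hc).1 h,
    fun h => ⟨b, rfl, h⟩⟩

/-- The tuples in `s` are shattered by the realizations of each type in `F`. -/
def ShatteredOver (φ : L.Formula (α ⊕ β)) {A : Set U} (F : Set (TypesOver L A β))
    (s : Finset (α → U)) : Prop :=
  ∀ q ∈ F, ∀ I : Set (α → U), ∃ c : β → U, tp L A c = q ∧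
    ∀ a ∈ s, φ.Realize (Sum.elim a c) ↔ a ∈ I

-- The new tuple realizes `p` over witnesses for all patterns on `s` at all types in `D`. By
-- invariance its $\phi$-value at a witness depends only on the type, and `hd` says that either
-- value occurs densely in `F`.
open scoped Classical in
theorem ShatteredOver.exists_insert {φ : L.Formula (α ⊕ β)} {A : Set U} (p : Inv φ A)
    {κ : Cardinal.{w}} (hκ : ℵ₀ < κ) (hU : IsMonster L U κ) (hA : A.Countable)
    [Finite α] [Finite β] {F D : Set (TypesOver L A β)} (hF : F.Nonempty) (hDF : D ⊆ F)
    (hD : D.Countable)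
    (hd : ∀ v : Prop, F ⊆ closure
      {q ∈ D | ∃ c : β → U, tp L A c = q ∧ (inst φ c ∈ p.1.formulas ↔ v)})
    {s : Finset (α → U)} (hs : ShatteredOver φ F s) :
    ∃ a ∉ s, ShatteredOver φ F (insert a s) := by
  have : Countable D := hD.to_subtype
  choose c hc hcs using fun (i : D × s.powerset) => hs i.1 (hDF i.1.2) (i.2.1 : Set (α → U))
  obtain ⟨a, ha⟩ := p.1.exists_realize hκ hU.1 (countable_range c)
  have key : ∀ q ∈ F, ∀ (I : Set (α → U)) (v : Prop), ∃ e : β → U, tp L A e = q ∧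
      (φ.Realize (Sum.elim a e) ↔ v) ∧ ∀ x ∈ s, φ.Realize (Sum.elim x e) ↔ x ∈ I := by
    intro q hq I v
    let C : Set U := ⋃ x ∈ insert a s, range x
    have hC : C.Countable := (insert a s).countable_toSet.biUnion fun x _ => countable_range x
    have hx : ∀ x ∈ insert a s, range x ⊆ C := fun x hx =>
      subset_biUnion_of_mem (s := {x | x ∈ insert a s}) (u := range) hx
    let W : Set (β → U) := {e | φ.Realize (Sum.elim a e) ↔ v} ∩
      ⋂ x ∈ s.attach, {e | φ.Realize (Sum.elim x.1 e) ↔ x.1 ∈ I}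
    have hW : C.Definable L W :=
      (definable_setOf_realize_right φ (hx a (Finset.mem_insert_self a s)) v).inter
        (definable_biInter_finset (fun x : {x // x ∈ s} => definable_setOf_realize_right φ
          (hx x.1 (Finset.mem_insert_of_mem x.2)) (x.1 ∈ I)) s.attach)
    have hcl := hU.1.isClosed_image_tp (mk_lt_of_countable hκ (hA.union hC)) hW
    -- The closed set of types of elements of `W` contains every type in `D` with value `v`, hence
    -- all of `F`.
    obtain ⟨e, he, rfl⟩ := closure_minimal (by
      rintro _ ⟨hqD, e, rfl, he⟩
      have hI : s.filter (· ∈ I) ∈ s.powerset := Finset.mem_powerset.2 (Finset.filter_subset _ _)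
      let i : D × s.powerset := (⟨_, hqD⟩, ⟨_, hI⟩)
      refine ⟨c i, ⟨?_, mem_iInter₂.2 fun x _ => ?_⟩, hc i⟩
      · exact (ha _ (mem_range_self i)).trans
          ((p.inst_mem_iff_of_tp_eq hκ hU.2 hA (hc i)).trans he)
      · refine (hcs i x.1 x.2).trans ?_
        simp [i]) hcl (hd v hq)
    exact ⟨e, rfl, he.1, fun x hx => mem_iInter₂.1 he.2 ⟨x, hx⟩ (Finset.mem_attach _ _)⟩
  refine ⟨a, fun has => ?_, fun q hq I => ?_⟩
  -- If `a` were in `s`, the empty pattern on `s` together with the value `True` at `a` would be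
  -- contradictory.
  · obtain ⟨q, hq⟩ := hF
    obtain ⟨e, -, h, h'⟩ := key q hq ∅ True
    exact (h' a has).1 (h.2 trivial)
  · obtain ⟨e, he, h, h'⟩ := key q hq I (a ∈ I)
    refine ⟨e, he, fun x hx => ?_⟩
    rcases Finset.mem_insert.1 hx with rfl | hx
    · exact h
    · exact h' x hx

/-- Iterating the extension gives an increasing chain of shattered finite sets; by saturation each
subset of its infinite union is cut out by a single tuple. -/
theorem not_isNIP_of_shatteredOver {φ : L.Formula (α ⊕ β)} {κ : Cardinal.{w}} (hκ : ℵ₀ < κ)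
    (hU : IsSaturated L U κ) [Finite α] [Finite β] {A : Set U} {F : Set (TypesOver L A β)}
    (hF : F.Nonempty) (h : ∀ s : Finset (α → U), ShatteredOver φ F s →
      ∃ t, s ⊂ t ∧ ShatteredOver φ F t)
    (h0 : ShatteredOver φ F ∅) : ¬ IsNIP U φ := by
  classical
  rw [IsNIP, not_not]
  choose! next hlt hnext using h
  let s : ℕ → Finset (α → U) := fun n => next^[n] ∅
  have hs : ∀ n, ShatteredOver φ F (s n) := fun n => by
    induction n with
    | zero => exact h0
    | succ n ih => simpa only [s, Function.iterate_succ_apply'] using hnext _ ih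
  have hmono : StrictMono s := strictMono_nat_of_lt_succ fun n => by
    simpa only [s, Function.iterate_succ_apply'] using hlt _ (hs n)
  let S : Set (α → U) := ⋃ n, (s n : Set (α → U))
  have hS : S.Countable := countable_iUnion fun n => (s n).countable_toSet
  refine ⟨S, fun hfin => ?_, ?_⟩
  · have hle : ∀ n, s n ≤ hfin.toFinset := fun n x hx =>
      hfin.mem_toFinset.2 (mem_iUnion.2 ⟨n, hx⟩)
    have hcard : StrictMono fun n => (s n).card := fun m n hmn => Finset.card_lt_card (hmono hmn)
    have := hcard.le_apply (x := hfin.toFinset.card + 1)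
    have := Finset.card_le_card (hle (hfin.toFinset.card + 1))
    omega
  · suffices h : ∀ I : Set (α → U), ∃ b : β → U, ∀ a ∈ S, φ.Realize (Sum.elim a b) ↔ a ∈ I by
      choose b hb using h
      exact ⟨b, fun I _ => hb I⟩
    intro I
    let C : Set U := ⋃ a ∈ S, range a
    have hC : C.Countable := hS.biUnion fun a _ => countable_range a
    obtain ⟨q, hq⟩ := hF
    obtain ⟨b, hb⟩ := hU.nonempty_iInter (mk_lt_of_countable hκ hC)
      (s := fun a : S => {b : β → U | φ.Realize (Sum.elim a.1 b) ↔ a.1 ∈ I})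
      (fun a => definable_setOf_realize_right φ (subset_biUnion_of_mem (u := range) a.2) _)
      fun t => by
        -- Finitely many tuples of the union all appear at one stage of the chain, which is
        -- shattered.
        choose n hn using fun a : S => mem_iUnion.1 a.2
        obtain ⟨b, -, hb⟩ := hs (t.sup n) q hq I
        exact ⟨b, mem_iInter₂.2 fun a ha =>
          hb a.1 (hmono.monotone (Finset.le_sup (f := n) ha) (hn a))⟩
    rw [mem_iInter] at hb
    exact ⟨b, fun a ha => hb ⟨a, ha⟩⟩

theorem isBaireOne_dFun {φ : L.Formula (α ⊕ β)} (hL : L.card ≤ ℵ₀) {κ : Cardinal.{w}}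
    (hκ : ℵ₀ < κ) (hU : IsMonster L U κ) [Finite α] [Finite β] (hφ : IsNIP U φ) {A : Set U}
    (hA : A.Countable) (p : Inv φ A) : IsBaireOne (dFun p) := by
  classical
  have : Countable A := hA.to_subtype
  have := polishSpace_typesOver hL A (β := β)
  have hsurj := hU.1.surjective_tp (mk_lt_of_countable hκ hA) (β := β)
  let s : Set (TypesOver L A β) := {q | ∃ b : β → U, tp L A b = q ∧ inst φ b ∈ p.1.formulas}
  have hind : dFun p = s.indicator (1 : TypesOver L A β → ℝ) := by
    funext q
    simp [dFun, indicator, s]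
  suffices h : IsFSigma s ∧ IsFSigma sᶜ from hind ▸ isBaireOne_indicator h.1 h.2
  refine isFSigma_and_compl fun F _ h1 h2 => ?_
  by_contra hne
  have hF : F.Nonempty := nonempty_iff_ne_empty.2 hne
  have hmem : ∀ c : β → U, tp L A c ∈ s ↔ inst φ c ∈ p.1.formulas := fun c =>
    ⟨fun ⟨b, hb, h⟩ => (p.inst_mem_iff_of_tp_eq hκ hU.2 hA hb).1 h, fun h => ⟨c, rfl, h⟩⟩
  let _ := TopologicalSpace.metrizableSpaceMetric (TypesOver L A β)
  have hsep : ∀ t : Set (TypesOver L A β), ∃ D ⊆ t, D.Countable ∧ t ⊆ closure D := fun t =>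
    (TopologicalSpace.IsSeparable.of_separableSpace t).exists_countable_dense_subset
  -- Density is needed for each value of $d_p$ separately, so countable dense subsets are taken in
  -- `F ∩ s` and in `F ∩ sᶜ`.
  obtain ⟨D, hDs, hD, hDd⟩ := hsep (F ∩ s)
  obtain ⟨E, hEs, hE, hEd⟩ := hsep (F ∩ sᶜ)
  have hd : ∀ v : Prop, F ⊆ closure
      {q ∈ D ∪ E | ∃ c : β → U, tp L A c = q ∧ (inst φ c ∈ p.1.formulas ↔ v)} := fun v => by
    by_cases hv : v
    · refine (h1.trans (closure_minimal hDd isClosed_closure)).trans (closure_mono fun q hq => ?_)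
      obtain ⟨c, rfl⟩ := hsurj q
      exact ⟨Or.inl hq, c, rfl, iff_of_true ((hmem c).1 (hDs hq).2) hv⟩
    · refine (h2.trans (closure_minimal hEd isClosed_closure)).trans (closure_mono fun q hq => ?_)
      obtain ⟨c, rfl⟩ := hsurj q
      exact ⟨Or.inr hq, c, rfl, iff_of_false (fun h => (hEs hq).2 ((hmem c).2 h)) hv⟩
  refine not_isNIP_of_shatteredOver hκ hU.1 hF (fun t ht => ?_) (fun q _ I => ?_) hφ
  · obtain ⟨a, ha, h⟩ := ShatteredOver.exists_insert p hκ hU hA hF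
      (union_subset (hDs.trans inter_subset_left) (hEs.trans inter_subset_left))
      (hD.union hE) hd ht
    exact ⟨_, Finset.ssubset_insert ha, h⟩
  · obtain ⟨c, hc⟩ := hsurj q
    exact ⟨c, hc, by simp⟩

/-- The map `p ↦ d_p` is continuous for the topology of pointwise convergence. -/
theorem continuous_dFun {φ : L.Formula (α ⊕ β)} {κ : Cardinal.{w}}
    (hκ : ℵ₀ < κ) (hU : IsMonster L U κ) [Finite β] {A : Set U} (hA : A.Countable) :
    Continuous (dFun : Inv φ A → TypesOver L A β → ℝ) := by
  classical
  refine continuous_pi fun q => ?_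
  obtain ⟨b, rfl⟩ := hU.1.surjective_tp (mk_lt_of_countable hκ hA) q
  simp only [dFun_tp _ hκ hU.2 hA]
  refine Continuous.if (fun p hp => ?_) continuous_const continuous_const
  have hc : IsClopen {p : Inv φ A | inst φ b ∈ p.1.formulas} :=
    (LocalType.isClopen_inst_mem b).preimage continuous_subtype_val
  rw [hc.frontier_eq] at hp
  exact hp.elim

theorem injective_dFun {φ : L.Formula (α ⊕ β)} {κ : Cardinal.{w}}
    (hκ : ℵ₀ < κ) (hU : IsMonster L U κ) [Finite β] {A : Set U} (hA : A.Countable) :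
    Function.Injective (dFun : Inv φ A → TypesOver L A β → ℝ) := by
  classical
  refine fun p q h => Subtype.ext (LocalType.ext_inst fun b => ?_)
  have := congrFun h (tp L A b)
  rw [dFun_tp p hκ hU.2 hA, dFun_tp q hκ hU.2 hA] at this
  split_ifs at this <;> simp_all

end ModelTypes

theorem mainTheorem4 {L : FirstOrder.Language} {U : Type*} [L.Structure U] [Nonempty U]
    (T : L.Theory) [U ⊨ T] (hL : L.card ≤ ℵ₀)
    (κ : Cardinal) (hκ : ℵ₀ < κ) (hU : ModelTypes.IsMonster L U κ)
    (M : L.ElementarySubstructure U) (hM : Countable M)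
    {α β : Type*} [Finite α] [Finite β]
    (φ : L.Formula (α ⊕ β)) (hφ : ModelTypes.IsNIP U φ) :
    IsRosenthalCompactum (ModelTypes.Inv φ (M : Set U)) ∧
    PolishSpace (ModelTypes.TypesOver L (M : Set U) β) ∧
    ∃ h : ∀ p : ModelTypes.Inv φ (M : Set U), IsBaireOne (ModelTypes.dFun p),
      IsEmbedding (fun p : ModelTypes.Inv φ (M : Set U) =>
        (⟨ModelTypes.dFun p, h p⟩ : BaireOne (ModelTypes.TypesOver L (M : Set U) β))) ∧
      IsCompact (Set.range (fun p : ModelTypes.Inv φ (M : Set U) =>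
        (⟨ModelTypes.dFun p, h p⟩ : BaireOne (ModelTypes.TypesOver L (M : Set U) β)))) := by

  have hA : (M : Set U).Countable := hM.to_set
  have : Countable (M : Set U) := hM
  have hP := ModelTypes.polishSpace_typesOver hL (M : Set U) (β := β)
  have h := ModelTypes.isBaireOne_dFun hL hκ hU hφ hA
  have hcont : Continuous (fun p : ModelTypes.Inv φ (M : Set U) =>
      (⟨ModelTypes.dFun p, h p⟩ : BaireOne (ModelTypes.TypesOver L (M : Set U) β))) :=
    (ModelTypes.continuous_dFun hκ hU hA).subtype_mk h
  -- A continuous injection from a compact space to a Hausdorff space is a closed embedding.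
  have he := (hcont.isClosedEmbedding fun p q hpq =>
    ModelTypes.injective_dFun hκ hU hA (congrArg Subtype.val hpq)).isEmbedding
  exact ⟨isRosenthalCompactum_of_isEmbedding he, hP, h, he, isCompact_range hcont⟩
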